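/- For a permutation $\pi$ of $[n]=\{1,\dots,n\}$ let $P_\pi$ be the poset on $[n]$ with $a\prec b$ if and only if $a<b$ and $\pi(a)<\pi(b)$, and let $\bar\pi$ be the permutation $\bar\pi(a)=n+1-\pi(a)$. A linear extension of a finite poset $(V,\preceq)$ with $m$ elements is a bijection $\ell:V\to[m]$ such that $a\prec b$ implies $\ell(a)<\ell(b)$. For $0\le j\le n$ and $\tau\in S_n$ put $J=\tau^{-1}([j])$, $J^c=[n]\setminus J$, and define $L_j\tau:J\to[j]$ by $L_j\tau(a)=\tau(a)$ and $R_j\tau:J^c\to[n-j]$ by $R_j\tau(a)=\tau(a)-j$. For partial orders $P,Q$ on $[n]$ let $X_j(P,Q)$ be the set of all $\tau\in S_n$ such that $L_j\tau$ is a linear extension of the restriction $P|_J$ and $R_j\tau$ is a linear extension of the restriction $Q|_{J^c}$, and let $e_j(P,Q)=|X_j(P,Q)|$. **Theorem (Mixed Sidorenko inequality).** Let $n\ge 0$, $\pi,\sigma\in S_n$ and $0\le j\le n$. Then $$e_j(P_\pi,P_\sigma)\cdot e_j(P_{\bar\pi},P_{\bar\sigma})\ \ge\ n!\binom nj .$$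 Moreover, for the uniform probability measure $\mathbb P$ on $S_n$, the events $A=X_j(P_\pi,P_\sigma)$ and $B=X_j(P_{\bar\pi},P_{\bar\sigma})$ are negatively correlated: $\mathbb P(A\cap B)\le \mathbb P(A)\,\mathbb P(B)$. -/

import Mathlib

/-- A linear extension of a poset `P` on `V`: a bijection `ℓ : V → {0, …, m - 1}`
(so that `m = |V|`) with `a ≺ b → ℓ a < ℓ b`. -/
def IsLinearExtension {V : Type*} (P : PartialOrder V) {m : ℕ} (ℓ : V → Fin m) : Prop :=
  Function.Bijective ℓ ∧ ∀ a b : V, P.lt a b → ℓ a < ℓ b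

/-- The restriction `P|_J` of a partial order to a subset `J` of its ground set. -/
@[reducible] def posetRestrict {V : Type*} (P : PartialOrder V) (J : Set V) : PartialOrder J :=
  @PartialOrder.lift J V P Subtype.val Subtype.val_injective

/-- The poset `P_π` on `{0, …, n - 1}`: `a ≺ b` iff `a < b` and `π a < π b`. -/
@[reducible] def permPoset {n : ℕ} (π : Equiv.Perm (Fin n)) : PartialOrder (Fin n) where
  le a b := a ≤ b ∧ π a ≤ π b
  lt a b := a < b ∧ π a < π b
  le_refl a := ⟨le_refl _, le_refl _⟩
  le_trans _ _ _ h₁ h₂ := ⟨h₁.1.trans h₂.1, h₁.2.trans h₂.2⟩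
  le_antisymm _ _ h₁ h₂ := le_antisymm h₁.1 h₂.1
  lt_iff_le_not_ge a b := by
    constructor
    · intro h
      exact ⟨⟨h.1.le, h.2.le⟩, fun h' => absurd h.1 (not_lt.mpr h'.1)⟩
    · intro h
      have hne : a ≠ b := by
        rintro rfl
        exact h.2 h.1
      exact ⟨lt_of_le_of_ne h.1.1 hne, lt_of_le_of_ne h.1.2 fun e => hne (π.injective e)⟩

/-- The reversed permutation `a ↦ n - 1 - π a` of `{0, …, n - 1}`
(that is, `a ↦ n + 1 - π a` on `{1, …, n}`). -/
def permBar {n : ℕ} (π : Equiv.Perm (Fin n)) : Equiv.Perm (Fin n) :=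
  π.trans Fin.revPerm

/-- The set `J = τ⁻¹({0, …, j - 1})` of elements that `τ` sends to the first `j` positions. -/
def lowerSet {n : ℕ} (j : ℕ) (τ : Equiv.Perm (Fin n)) : Set (Fin n) :=
  {a | (τ a : ℕ) < j}

/-- The restriction `L_j τ : J → {0, …, j - 1}` of `τ` to `J`. -/
def leftPart {n : ℕ} (j : ℕ) (τ : Equiv.Perm (Fin n)) : lowerSet j τ → Fin j :=
  fun a => ⟨(τ a.1 : ℕ), a.2⟩

/-- The map `R_j τ : Jᶜ → {0, …, n - j - 1}`, `a ↦ τ a - j`. The subtraction never truncates,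
because `j ≤ τ a` for `a ∉ J`. -/
def rightPart {n : ℕ} (j : ℕ) (τ : Equiv.Perm (Fin n)) :
    ((lowerSet j τ)ᶜ : Set (Fin n)) → Fin (n - j) :=
  fun a => ⟨(τ a.1 : ℕ) - j, by
    have h₁ : ¬ (τ a.1 : ℕ) < j := a.2
    have h₂ : (τ a.1 : ℕ) < n := (τ a.1).isLt
    omega⟩

/-- The set (event) of permutations `τ` such that `L_j τ` is a linear extension of `P|_J` and
`R_j τ` is a linear extension of `Q|_{Jᶜ}`, where `J = τ⁻¹({0, …, j - 1})`. -/
def mixedEvent {n : ℕ} (P Q : PartialOrder (Fin n)) (j : ℕ) : Set (Equiv.Perm (Fin n)) :=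
  {τ | IsLinearExtension (posetRestrict P (lowerSet j τ)) (leftPart j τ) ∧
    IsLinearExtension (posetRestrict Q (lowerSet j τ)ᶜ) (rightPart j τ)}

/-- The number `e_j(P, Q)`. -/
noncomputable def mixedCount {n : ℕ} (P Q : PartialOrder (Fin n)) (j : ℕ) : ℕ :=
  (mixedEvent P Q j).ncard

/-- The uniform probability measure on the permutations of `{0, …, n - 1}`
(all sets of permutations being measurable). -/
noncomputable def uniformPermMeasure (n : ℕ) :
    @MeasureTheory.Measure (Equiv.Perm (Fin n)) ⊤ :=
  @PMF.toMeasure (Equiv.Perm (Fin n)) ⊤ (PMF.uniformOfFintype (Equiv.Perm (Fin n)))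

/-- Two events in the uniform probability space of permutations are negatively correlated if
the probability of both is at most the product of their probabilities. -/
def NegativelyCorrelated {n : ℕ} (A B : Set (Equiv.Perm (Fin n))) : Prop :=
  uniformPermMeasure n (A ∩ B) ≤ uniformPermMeasure n A * uniformPermMeasure n B

/-! Write e(S) for the number of linear extensions on S. Grouping τ by J = τ⁻¹([j]) gives e_j(P, Q)
≥ ∑_J e(P|J) e(Q|Jᶜ). Sidorenko's inequality on each block bounds the product of matching terms for
the two pairs of posets below by j!(n-j)!, so Cauchy–Schwarz over the C(n,j) sets J gives C(n,j)²
j!(n-j)! = n! C(n,j).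

Sidorenko's inequality, `factorial_card_le_card_linExts_mul`, follows by induction from the weighted
bound `sum_card_linExts_erase_mul_le`: if q has sum at most M on every chain, then ∑ₓ e(S∖x) q(x) ≤
e(S) M.

For the correlation, τ ∈ A ∩ B is increasing on J and on Jᶜ, hence determined by J. So |A ∩ B| ≤
C(n,j), and the inequality just proved gives n! |A ∩ B| ≤ |A| |B|. -/

open scoped Classical in
/-- The linear extensions of a relation `r` on a finite set `S`, as lists of the elements of `S`. -/
noncomputable def linExts {V : Type*} (r : V → V → Prop) (S : Finset V) : Finset (List V) :=
  (Multiset.lists S.1).toFinset.filter fun l => l.Pairwise fun a b => ¬ r b a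

open scoped Classical in
/-- The minimal elements of a finite set `S` with respect to a relation `r`. -/
noncomputable def minElts {V : Type*} (r : V → V → Prop) (S : Finset V) : Finset V :=
  S.filter fun y => ∀ z ∈ S, ¬ r z y

/-! ### Counting linear extensions and Sidorenko's inequality -/

section LinearExtensions

variable {V : Type*} {r s : V → V → Prop} {S : Finset V}

theorem mem_minElts {y : V} : y ∈ minElts r S ↔ y ∈ S ∧ ∀ z ∈ S, ¬ r z y := by
  simp [minElts]

variable [DecidableEq V]

theorem mem_linExts {l : List V} :
    l ∈ linExts r S ↔ (l.Nodup ∧ l.toFinset = S) ∧ l.Pairwise fun a b => ¬ r b a := by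
  simp only [linExts, Finset.mem_filter, Multiset.mem_toFinset, Multiset.mem_lists_iff]
  refine and_congr_left fun _ => ⟨fun h => ?_, fun h => ?_⟩
  · have hl : l.Nodup := by
      have := S.2
      rw [h] at this
      simpa using this
    refine ⟨hl, Finset.ext fun a => ?_⟩
    rw [List.mem_toFinset, ← Finset.mem_val, h]
    simp
  · rw [← h.2, List.toFinset_val, h.1.dedup]
    rfl

theorem card_linExts_empty : (linExts r (∅ : Finset V)).card = 1 := by
  rw [Finset.card_eq_one]
  refine ⟨[], Finset.ext fun l => ?_⟩
  rw [mem_linExts, Finset.mem_singleton]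
  constructor
  · rintro ⟨⟨-, h⟩, -⟩
    simpa using h
  · rintro rfl
    simp

/-- Split by the first element of the list, which must be minimal. The empty set is excluded: it has
one extension but no first element. -/
theorem card_linExts_eq_sum [Std.Irrefl r] (hS : S.Nonempty) :
    (linExts r S).card = ∑ y ∈ minElts r S, (linExts r (S.erase y)).card := by
  have h : linExts r S =
      (minElts r S).biUnion fun y => (linExts r (S.erase y)).image (List.cons y) := by
    ext l
    simp only [Finset.mem_biUnion, Finset.mem_image, mem_linExts, mem_minElts]
    constructor
    · rintro ⟨⟨hn, ht⟩, hp⟩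
      cases l with
      | nil =>
        rw [← ht] at hS
        simp at hS
      | cons y l =>
        rw [List.nodup_cons] at hn
        rw [List.pairwise_cons] at hp
        refine ⟨y, ⟨?_, fun z hz => ?_⟩, l, ⟨⟨hn.2, ?_⟩, hp.2⟩, rfl⟩
        · simp [← ht]
        · rw [← ht, List.mem_toFinset, List.mem_cons] at hz
          rcases hz with rfl | hz
          · exact irrefl z
          · exact hp.1 z hz
        · rw [← ht, List.toFinset_cons, Finset.erase_insert]
          simpa using hn.1
    · rintro ⟨y, ⟨hy, hmin⟩, l, ⟨⟨hn, ht⟩, hp⟩, rfl⟩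
      have hmem : ∀ z, z ∈ l ↔ z ≠ y ∧ z ∈ S := fun z => by
        rw [← List.mem_toFinset, ht, Finset.mem_erase]
      refine ⟨⟨List.nodup_cons.2 ⟨fun h => ((hmem y).1 h).1 rfl, hn⟩, ?_⟩,
        List.pairwise_cons.2 ⟨fun z hz => hmin z ((hmem z).1 hz).2, hp⟩⟩
      rw [List.toFinset_cons, ht, Finset.insert_erase hy]
  rw [h, Finset.card_biUnion]
  · exact Finset.sum_congr rfl fun y _ => Finset.card_image_of_injective _ List.cons_injective
  · intro y _ z _ hyz
    rw [Function.onFun, Finset.disjoint_left]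
    intro l hl hl'
    obtain ⟨a, -, rfl⟩ := Finset.mem_image.1 hl
    obtain ⟨b, -, hb⟩ := Finset.mem_image.1 hl'
    exact hyz (List.cons.inj hb).1.symm

/-- Removing first `x` and then a minimal element `y` of the rest: either `y` was already minimal,
or `x` is minimal and lies below `y`. -/
theorem mem_minElts_erase_iff [IsStrictOrder V r] {x y : V} (hx : x ∈ S) (hy : y ∈ S) :
    y ∈ minElts r (S.erase x) ↔
      (y ∈ minElts r S ∧ y ≠ x) ∨ (x ∈ minElts r S ∧ y ∈ minElts r (S.erase x) ∧ r x y) := by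
  simp only [mem_minElts, Finset.mem_erase]
  constructor
  · rintro ⟨⟨hne, -⟩, h⟩
    by_cases hxy : r x y
    · refine Or.inr ⟨⟨hx, fun z hz hzx => h z ⟨?_, hz⟩ (_root_.trans hzx hxy)⟩, ⟨⟨hne, hy⟩, h⟩, hxy⟩
      rintro rfl
      exact irrefl z hzx
    · refine Or.inl ⟨⟨hy, fun z hz hzy => ?_⟩, hne⟩
      by_cases hzx : z = x
      · exact hxy (hzx ▸ hzy)
      · exact h z ⟨hzx, hz⟩ hzy
  · rintro (⟨⟨-, h⟩, hne⟩ | ⟨-, h, -⟩)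
    · exact ⟨⟨hne, hy⟩, fun z hz => h z hz.2⟩
    · exact h

theorem ite_zero_eq_add_of_iff_or {p a b : Prop} [Decidable p] [Decidable a] [Decidable b]
    (h : p ↔ a ∨ b) (hab : ¬ (a ∧ b)) (n : ℕ) :
    (if p then n else 0) = (if a then n else 0) + if b then n else 0 := by
  by_cases ha : a <;> by_cases hb : b <;> simp_all

-- Expand e(S∖x) over the minimal y of S∖x. Either y is minimal in S, or x is minimal in S and lies
-- below y; swapping names in the second case makes the removed minimal element y throughout.
-- Induction then applies to S∖y, with the weight of y moved onto the new minimal elements above it.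
open scoped Classical in
theorem sum_card_linExts_erase_mul_le [IsStrictOrder V r] (S : Finset V) (q : V → ℕ) (M : ℕ)
    (hq : ∀ C ⊆ S, IsChain r (C : Set V) → ∑ x ∈ C, q x ≤ M) :
    ∑ x ∈ S, (linExts r (S.erase x)).card * q x ≤ (linExts r S).card * M := by
  induction hn : S.card generalizing S q with
  | zero =>
    rw [Finset.card_eq_zero.1 hn]
    simp
  | succ n ih =>
    have hS : S.Nonempty := Finset.card_pos.1 (by omega)
    -- A singleton is treated apart, since `hrec` needs `S.erase x` nonempty.
    rcases n.eq_zero_or_pos with rfl | hpos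
    · obtain ⟨x, rfl⟩ := Finset.card_eq_one.1 hn
      have hx : minElts r {x} = {x} := by
        ext y
        simp only [mem_minElts, Finset.mem_singleton, forall_eq, and_iff_left_iff_imp]
        rintro rfl
        exact irrefl y
      rw [card_linExts_eq_sum hS, hx]
      simpa [card_linExts_empty] using hq {x} subset_rfl (by simp)
    · let e : V → V → ℕ := fun x y => (linExts r ((S.erase x).erase y)).card
      have he : ∀ x y, e x y = e y x := fun x y => by
        simp only [e, Finset.erase_right_comm]
      have hrec : ∀ x ∈ S,
          (linExts r (S.erase x)).card = ∑ y ∈ minElts r (S.erase x), e x y := fun x hx =>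
        card_linExts_eq_sum (Finset.card_pos.1 (by rw [Finset.card_erase_of_mem hx]; omega))
      -- The weight that z inherits from y when removing y leaves z minimal and z lies above y.
      let d : V → V → ℕ := fun y z => if z ∈ minElts r (S.erase y) ∧ r y z then q y else 0
      let q' : V → V → ℕ := fun y z => q z + d y z
      have hstep : ∀ y ∈ minElts r S,
          ∑ z ∈ S.erase y, e y z * q' y z ≤ (linExts r (S.erase y)).card * M := by
        intro y hy
        have hyS := (mem_minElts.1 hy).1
        refine ih (S.erase y) (q' y) (fun C hC hch => ?_)
          (by rw [Finset.card_erase_of_mem hyS]; omega)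
        have hCS : C ⊆ S := hC.trans (Finset.erase_subset _ _)
        have hyC : y ∉ C := fun h => (Finset.mem_erase.1 (hC h)).1 rfl
        simp only [q', Finset.sum_add_distrib]
        by_cases hex : ∃ z ∈ C, z ∈ minElts r (S.erase y) ∧ r y z
        · obtain ⟨z, hz, hzm, hyz⟩ := hex
          -- A chain has at most one inheriting element, its least one z; prepending y gives a chain
          -- of S whose q-weight is the new weight of C.
          have hle : ∀ w ∈ C, w ≠ z → r z w := fun w hw hwz =>
            (hch hz hw hwz.symm).resolve_right ((mem_minElts.1 hzm).2 w (hC hw))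
          rw [Finset.sum_eq_single_of_mem (f := d y) z hz,
            show d y z = q y from if_pos ⟨hzm, hyz⟩]
          · have := hq (insert y C) (Finset.insert_subset hyS hCS) (by
              rw [Finset.coe_insert]
              refine hch.insert fun w hw _ => Or.inl ?_
              by_cases hwz : w = z
              · exact hwz ▸ hyz
              · exact _root_.trans hyz (hle w hw hwz))
            rw [Finset.sum_insert hyC] at this
            omega
          · intro w hw hwz
            refine if_neg fun h => (mem_minElts.1 h.1).2 z (hC hz) (hle w hw hwz)
        · rw [Finset.sum_eq_zero (f := d y) (fun z hz => if_neg fun h => hex ⟨z, hz, h⟩), add_zero]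
          exact hq C hCS hch
      calc ∑ x ∈ S, (linExts r (S.erase x)).card * q x
          = ∑ x ∈ S, ∑ y ∈ S, if y ∈ minElts r (S.erase x) then e x y * q x else 0 := by
            refine Finset.sum_congr rfl fun x hx => ?_
            rw [hrec x hx, Finset.sum_mul, ← Finset.sum_filter]
            refine Finset.sum_congr (Finset.ext fun y => ?_) fun _ _ => rfl
            simp only [Finset.mem_filter, mem_minElts, Finset.mem_erase]
            tauto
        _ = ∑ x ∈ S, ∑ y ∈ S, ((if y ∈ minElts r S ∧ y ≠ x then e x y * q x else 0) +
              if x ∈ minElts r S ∧ y ∈ minElts r (S.erase x) ∧ r x y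
                then e x y * q x else 0) := by
            refine Finset.sum_congr rfl fun x hx => Finset.sum_congr rfl fun y hy => ?_
            have h := mem_minElts_erase_iff (r := r) hx hy
            have hdis : ¬ ((y ∈ minElts r S ∧ y ≠ x) ∧
                (x ∈ minElts r S ∧ y ∈ minElts r (S.erase x) ∧ r x y)) := fun h =>
              (mem_minElts.1 h.1.1).2 x hx h.2.2.2
            exact ite_zero_eq_add_of_iff_or h hdis _
        _ = ∑ y ∈ S, ∑ z ∈ S, ((if y ∈ minElts r S ∧ y ≠ z then e y z * q z else 0) +
              if y ∈ minElts r S ∧ z ∈ minElts r (S.erase y) ∧ r y z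
                then e y z * q y else 0) := by
            simp only [Finset.sum_add_distrib]
            congr 1
            rw [Finset.sum_comm]
            simp only [he]
        _ = ∑ y ∈ minElts r S, ∑ z ∈ S.erase y, e y z * q' y z := by
            have : minElts r S = S.filter (· ∈ minElts r S) := by
              ext y
              simp only [Finset.mem_filter, mem_minElts]
              tauto
            conv_rhs => rw [this, Finset.sum_filter]
            refine Finset.sum_congr rfl fun y hy => ?_
            split_ifs with hm
            · refine (Finset.sum_erase (a := y) S ?_).symm.trans ?_
              · simp [irrefl (r := r) y]
              · refine Finset.sum_congr rfl fun z hz => ?_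
                have hne : y ≠ z := (Finset.mem_erase.1 hz).1.symm
                simp only [hm, hne, q', d, true_and, ne_eq, not_false_eq_true, if_true, mul_add,
                  mul_ite, mul_zero]
            · simp [hm]
        _ ≤ ∑ y ∈ minElts r S, (linExts r (S.erase y)).card * M := Finset.sum_le_sum hstep
        _ = (linExts r S).card * M := by rw [card_linExts_eq_sum hS, Finset.sum_mul]

/-- The weighted bound for the indicator of A: a chain meets an antichain at most once, so M = 1. -/
theorem sum_card_linExts_erase_le_of_isAntichain [IsStrictOrder V r] {A : Finset V} (hAS : A ⊆ S)
    (hA : IsAntichain r (A : Set V)) :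
    ∑ x ∈ A, (linExts r (S.erase x)).card ≤ (linExts r S).card := by
  have h := sum_card_linExts_erase_mul_le (r := r) S (fun x => if x ∈ A then 1 else 0) 1
    (fun C _ hC => by
      rw [← Finset.card_filter]
      refine Finset.card_le_one.2 fun a ha b hb => by_contra fun hab => ?_
      rw [Finset.mem_filter] at ha hb
      rcases hC ha.1 hb.1 hab with h | h
      · exact hA ha.2 hb.2 hab h
      · exact hA hb.2 ha.2 (Ne.symm hab) h)
  simpa [Finset.sum_ite_mem, Finset.inter_eq_right.2 hAS] using h

/-- **Sidorenko's inequality** for two strict orders without common comparable pairs. -/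
theorem factorial_card_le_card_linExts_mul [IsStrictOrder V r] [IsStrictOrder V s]
    (hrs : ∀ a b, r a b → ¬ s a b ∧ ¬ s b a) (S : Finset V) :
    S.card.factorial ≤ (linExts r S).card * (linExts s S).card := by
  induction hn : S.card generalizing S with
  | zero =>
    rw [Finset.card_eq_zero.1 hn]
    simp [card_linExts_empty]
  | succ n ih =>
    calc (n + 1).factorial = ∑ x ∈ S, n.factorial := by
          rw [Finset.sum_const, hn, smul_eq_mul, Nat.factorial_succ]
      _ ≤ ∑ x ∈ S, (linExts r (S.erase x)).card * (linExts s (S.erase x)).card :=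
          Finset.sum_le_sum fun x hx => ih _ (by rw [Finset.card_erase_of_mem hx]; omega)
      _ ≤ _ := by
          -- Here q(x) counts the s-extensions of S∖x and M those of S; an r-chain is an
          -- s-antichain.
          refine sum_card_linExts_erase_mul_le S _ _ fun C hC hch =>
            sum_card_linExts_erase_le_of_isAntichain hC fun a ha b hb hab h => ?_
          rcases hch ha hb hab with h' | h'
          · exact (hrs a b h').1 h
          · exact (hrs b a h').2 h

end LinearExtensions

/-! ### Permutations as concatenations of two linear extensions -/

theorem isLinearExtension_leftPart_iff {n j : ℕ} (hj : j ≤ n) (P : PartialOrder (Fin n))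
    (τ : Equiv.Perm (Fin n)) :
    IsLinearExtension (posetRestrict P (lowerSet j τ)) (leftPart j τ) ↔
      ∀ a b : Fin n, (τ a : ℕ) < j → (τ b : ℕ) < j → P.lt a b → τ a < τ b := by
  constructor
  · intro h a b ha hb hab
    exact h.2 ⟨a, ha⟩ ⟨b, hb⟩ hab
  · intro h
    refine ⟨⟨fun a b hab => ?_, fun i => ?_⟩, fun a b hab => h a b a.2 b.2 hab⟩
    · exact Subtype.ext (τ.injective (Fin.ext (Fin.mk.inj hab)))
    · have hi : (τ (τ.symm ⟨i, i.2.trans_le hj⟩) : ℕ) = i := by simp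
      exact ⟨⟨τ.symm ⟨i, i.2.trans_le hj⟩, hi.trans_lt i.2⟩, Fin.ext hi⟩

theorem isLinearExtension_rightPart_iff {n j : ℕ} (Q : PartialOrder (Fin n))
    (τ : Equiv.Perm (Fin n)) :
    IsLinearExtension (posetRestrict Q (lowerSet j τ)ᶜ) (rightPart j τ) ↔
      ∀ a b : Fin n, ¬ (τ a : ℕ) < j → ¬ (τ b : ℕ) < j → Q.lt a b → τ a < τ b := by
  constructor
  · intro h a b ha hb hab
    have h' : (τ a : ℕ) - j < (τ b : ℕ) - j := h.2 ⟨a, ha⟩ ⟨b, hb⟩ hab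
    exact Fin.lt_def.2 (by omega)
  · intro h
    refine ⟨⟨fun a b hab => ?_, fun i => ?_⟩, fun a b hab => ?_⟩
    · have h' : (τ a.1 : ℕ) - j = (τ b.1 : ℕ) - j := Fin.mk.inj hab
      have ha : ¬ (τ a.1 : ℕ) < j := a.2
      have hb : ¬ (τ b.1 : ℕ) < j := b.2
      exact Subtype.ext (τ.injective (Fin.ext (by omega)))
    · have hi : (τ (τ.symm ⟨i + j, by omega⟩) : ℕ) = i + j := by simp
      refine ⟨⟨τ.symm ⟨i + j, by omega⟩, fun hlt => ?_⟩, Fin.ext ?_⟩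
      · have hlt' : (τ (τ.symm ⟨i + j, by omega⟩) : ℕ) < j := hlt
        omega
      · change (τ (τ.symm ⟨i + j, by omega⟩) : ℕ) - j = i
        omega
    · have hlt := Fin.lt_def.1 (h a b a.2 b.2 hab)
      have ha : ¬ (τ a.1 : ℕ) < j := a.2
      change (τ a.1 : ℕ) - j < (τ b.1 : ℕ) - j
      omega

theorem mem_mixedEvent_iff {n j : ℕ} (hj : j ≤ n) {P Q : PartialOrder (Fin n)}
    {τ : Equiv.Perm (Fin n)} :
    τ ∈ mixedEvent P Q j ↔
      (∀ a b : Fin n, (τ a : ℕ) < j → (τ b : ℕ) < j → P.lt a b → τ a < τ b) ∧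
        ∀ a b : Fin n, ¬ (τ a : ℕ) < j → ¬ (τ b : ℕ) < j → Q.lt a b → τ a < τ b :=
  and_congr (isLinearExtension_leftPart_iff hj P τ) (isLinearExtension_rightPart_iff Q τ)

/-- The permutation sending each element to its position in a list without repetitions. -/
noncomputable def permOfList {n : ℕ} (l : List (Fin n)) (hn : l.Nodup) (hl : l.length = n) :
    Equiv.Perm (Fin n) :=
  have hmem : ∀ a, a ∈ l := fun a => by
    have h : l.toFinset = Finset.univ := by
      rw [← Finset.card_eq_iff_eq_univ, List.toFinset_card_of_nodup hn, hl, Fintype.card_fin]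
    rw [← List.mem_toFinset, h]
    exact Finset.mem_univ a
  Equiv.ofBijective (fun a => ⟨l.idxOf a, (List.idxOf_lt_length_iff.2 (hmem a)).trans_eq hl⟩)
    (Finite.injective_iff_bijective.1 fun a _ h => (List.idxOf_inj (hmem a)).1 (Fin.mk.inj h))

theorem permOfList_apply {n : ℕ} {l : List (Fin n)} (hn : l.Nodup) (hl : l.length = n)
    (a : Fin n) : (permOfList l hn hl a : ℕ) = l.idxOf a :=
  rfl

theorem permOfList_injective {n : ℕ} {l l' : List (Fin n)} {hn : l.Nodup} {hl : l.length = n}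
    {hn' : l'.Nodup} {hl' : l'.length = n} (h : permOfList l hn hl = permOfList l' hn' hl') :
    l = l' := by
  refine List.ext_getElem (hl.trans hl'.symm) fun i hi hi' => ?_
  have h₁ := permOfList_apply hn hl l[i]
  rw [h, permOfList_apply, hn.idxOf_getElem] at h₁
  have h₂ := List.getElem_idxOf (x := l[i]) (xs := l') (by omega)
  simp only [h₁] at h₂
  exact h₂.symm

theorem idxOf_lt_idxOf_of_pairwise {V : Type*} [DecidableEq V] {r : V → V → Prop}
    [Std.Irrefl r] {l : List V} (hp : l.Pairwise fun a b => ¬ r b a) {a b : V} (ha : a ∈ l)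
    (hb : b ∈ l) (hab : r a b) : l.idxOf a < l.idxOf b := by
  rcases lt_trichotomy (l.idxOf a) (l.idxOf b) with h | h | h
  · exact h
  · exact absurd hab ((List.idxOf_inj ha).1 h ▸ irrefl a)
  · have := List.pairwise_iff_getElem.1 hp _ _ (List.idxOf_lt_length_iff.2 hb)
      (List.idxOf_lt_length_iff.2 ha) h
    simp only [List.getElem_idxOf] at this
    exact absurd hab this

theorem isStrictOrder_partialOrder_lt {V : Type*} (P : PartialOrder V) :
    IsStrictOrder V P.lt where
  irrefl a := @lt_irrefl V P.toPreorder a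
  trans _ _ _ := @lt_trans V P.toPreorder _ _ _

/-- Concatenating extensions of J and Jᶜ is injective, because the cut is always after j entries.
Only this direction is needed. -/
theorem sum_card_linExts_mul_le_mixedCount {n j : ℕ} (hj : j ≤ n) (P Q : PartialOrder (Fin n)) :
    ∑ J ∈ (Finset.univ : Finset (Fin n)).powersetCard j,
      (linExts P.lt J).card * (linExts Q.lt Jᶜ).card ≤ mixedCount P Q j := by
  classical
  have := isStrictOrder_partialOrder_lt P
  have := isStrictOrder_partialOrder_lt Q
  let T : Finset (Σ _ : Finset (Fin n), List (Fin n) × List (Fin n)) :=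
    ((Finset.univ : Finset (Fin n)).powersetCard j).sigma
      fun J => linExts P.lt J ×ˢ linExts Q.lt Jᶜ
  have hT : ∀ x ∈ T, x.2.1.toFinset = x.1 ∧ x.2.1.length = j ∧ (x.2.1 ++ x.2.2).Nodup ∧
      (x.2.1 ++ x.2.2).length = n ∧ (x.2.1.Pairwise fun a b => ¬ P.lt b a) ∧
      (x.2.2.Pairwise fun a b => ¬ Q.lt b a) ∧ ∀ a, a ∉ x.2.1 → a ∈ x.2.2 := by
    rintro ⟨J, l₁, l₂⟩ hx
    simp only [T, Finset.mem_sigma, Finset.mem_powersetCard, Finset.mem_product, mem_linExts] at hx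
    obtain ⟨⟨-, hJ⟩, ⟨⟨hn₁, ht₁⟩, hp₁⟩, ⟨hn₂, ht₂⟩, hp₂⟩ := hx
    have hm₁ : ∀ a, a ∈ l₁ ↔ a ∈ J := fun a => by rw [← ht₁, List.mem_toFinset]
    have hm₂ : ∀ a, a ∈ l₂ ↔ a ∉ J := fun a => by
      rw [← Finset.mem_compl, ← ht₂, List.mem_toFinset]
    have hc₁ : l₁.length = j := by rw [← List.toFinset_card_of_nodup hn₁, ht₁, hJ]
    have hc₂ : l₂.length = n - j := by
      rw [← List.toFinset_card_of_nodup hn₂, ht₂, Finset.card_compl, hJ, Fintype.card_fin]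
    refine ⟨ht₁, hc₁, ?_, ?_, hp₁, hp₂, fun a ha => (hm₂ a).2 fun h => ha ((hm₁ a).2 h)⟩
    · refine List.nodup_append'.2 ⟨hn₁, hn₂, fun a ha hb => (hm₂ a).1 hb ((hm₁ a).1 ha)⟩
    · simp only [List.length_append]
      omega
  have hcard : T.card = ∑ J ∈ (Finset.univ : Finset (Fin n)).powersetCard j,
      (linExts P.lt J).card * (linExts Q.lt Jᶜ).card := by
    simp [T, Finset.card_sigma, Finset.card_product]
  rw [← hcard, ← Set.ncard_coe_finset]
  -- The value 1 off `T` is a dummy.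
  refine Set.ncard_le_ncard_of_injOn
    (fun x => if hx : x ∈ T then
      permOfList (x.2.1 ++ x.2.2) (hT x hx).2.2.1 (hT x hx).2.2.2.1 else 1) ?_ ?_ (Set.toFinite _)
  · intro x hx
    have hxT : x ∈ T := hx
    simp only [dif_pos hxT]
    obtain ⟨-, hlen, hn, hl, hp₁, hp₂, hm⟩ := hT x hxT
    have hlt : ∀ a, (permOfList (x.2.1 ++ x.2.2) hn hl a : ℕ) < j ↔ a ∈ x.2.1 := fun a => by
      rw [permOfList_apply, List.idxOf_append]
      split_ifs with h
      · simpa [h, ← hlen] using List.idxOf_lt_length_iff.2 h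
      · simp [h, hlen]
    refine (mem_mixedEvent_iff hj).2 ⟨fun a b ha hb hab => ?_, fun a b ha hb hab => ?_⟩
    · rw [hlt] at ha hb
      rw [Fin.lt_def, permOfList_apply, permOfList_apply, List.idxOf_append, List.idxOf_append,
        if_pos ha, if_pos hb]
      exact idxOf_lt_idxOf_of_pairwise hp₁ ha hb hab
    · rw [hlt] at ha hb
      rw [Fin.lt_def, permOfList_apply, permOfList_apply, List.idxOf_append, List.idxOf_append,
        if_neg ha, if_neg hb]
      exact Nat.add_lt_add_right (idxOf_lt_idxOf_of_pairwise hp₂ (hm a ha) (hm b hb) hab) _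
  · intro x hx y hy hxy
    have hxT : x ∈ T := hx
    have hyT : y ∈ T := hy
    simp only [dif_pos hxT, dif_pos hyT] at hxy
    have happ := List.append_inj (permOfList_injective hxy)
      ((hT x hxT).2.1.trans (hT y hyT).2.1.symm)
    have hJ : x.1 = y.1 := by rw [← (hT x hxT).1, ← (hT y hyT).1, happ.1]
    exact Sigma.ext hJ (heq_of_eq (Prod.ext happ.1 happ.2))

/-! ### The mixed inequality -/

theorem not_permPoset_permBar_lt {n : ℕ} (π : Equiv.Perm (Fin n)) (a b : Fin n)
    (h : (permPoset π).lt a b) :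
    ¬ (permPoset (permBar π)).lt a b ∧ ¬ (permPoset (permBar π)).lt b a := by
  refine ⟨fun h' => ?_, fun h' => lt_asymm h.1 h'.1⟩
  have h₁ : Fin.rev (π a) < Fin.rev (π b) := h'.2
  exact lt_asymm h.2 (Fin.rev_lt_rev.1 h₁)

theorem permPoset_lt_or_permBar_lt {n : ℕ} (π : Equiv.Perm (Fin n)) {a b : Fin n} (h : a < b) :
    (permPoset π).lt a b ∨ (permPoset (permBar π)).lt a b := by
  rcases lt_or_gt_of_ne (π.injective.ne h.ne) with h' | h'
  · exact Or.inl ⟨h, h'⟩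
  · exact Or.inr ⟨h, Fin.rev_lt_rev.2 h'⟩

/-- Cauchy–Schwarz with √c as the constant lower bound for √(f i · g i), hence the passage to ℝ. -/
theorem card_mul_le_sum_mul_sum {ι : Type*} (s : Finset ι) (f g : ι → ℕ) (c : ℕ)
    (h : ∀ i ∈ s, c ≤ f i * g i) : s.card ^ 2 * c ≤ (∑ i ∈ s, f i) * ∑ i ∈ s, g i := by
  have hcs := Finset.sum_sq_le_sum_mul_sum_of_sq_le_mul (R := ℝ) s (r := fun _ => √(c : ℝ))
    (f := fun i => (f i : ℝ)) (g := fun i => (g i : ℝ))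
    (fun _ _ => Nat.cast_nonneg _) (fun _ _ => Nat.cast_nonneg _) (fun i hi => by
      rw [Real.sq_sqrt (Nat.cast_nonneg _)]
      exact_mod_cast h i hi)
  rw [Finset.sum_const, nsmul_eq_mul, mul_pow, Real.sq_sqrt (Nat.cast_nonneg _)] at hcs
  exact_mod_cast hcs

/-- The mixed Sidorenko inequality, for partial orders without common comparable pairs. -/
theorem factorial_mul_choose_le_mixedCount_mul {n j : ℕ} (hj : j ≤ n)
    {P P' Q Q' : PartialOrder (Fin n)} (hP : ∀ a b, P.lt a b → ¬ P'.lt a b ∧ ¬ P'.lt b a)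
    (hQ : ∀ a b, Q.lt a b → ¬ Q'.lt a b ∧ ¬ Q'.lt b a) :
    n.factorial * n.choose j ≤ mixedCount P Q j * mixedCount P' Q' j := by
  have := isStrictOrder_partialOrder_lt P
  have := isStrictOrder_partialOrder_lt P'
  have := isStrictOrder_partialOrder_lt Q
  have := isStrictOrder_partialOrder_lt Q'
  have hprod : ∀ J ∈ (Finset.univ : Finset (Fin n)).powersetCard j,
      j.factorial * (n - j).factorial ≤
        ((linExts P.lt J).card * (linExts Q.lt Jᶜ).card) *
          ((linExts P'.lt J).card * (linExts Q'.lt Jᶜ).card) := by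
    intro J hJ
    have hcJ := (Finset.mem_powersetCard.1 hJ).2
    have h₁ := factorial_card_le_card_linExts_mul hP J
    have h₂ := factorial_card_le_card_linExts_mul hQ Jᶜ
    rw [hcJ] at h₁
    rw [Finset.card_compl, hcJ, Fintype.card_fin] at h₂
    rw [mul_mul_mul_comm]
    exact Nat.mul_le_mul h₁ h₂
  have hcs := card_mul_le_sum_mul_sum _ _ _ _ hprod
  rw [Finset.card_powersetCard, Finset.card_univ, Fintype.card_fin] at hcs
  have hfac : n.factorial * n.choose j = n.choose j ^ 2 * (j.factorial * (n - j).factorial) := by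
    rw [← Nat.choose_mul_factorial_mul_factorial hj]
    ring
  rw [hfac]
  exact hcs.trans (Nat.mul_le_mul (sum_card_linExts_mul_le_mixedCount hj P Q)
    (sum_card_linExts_mul_le_mixedCount hj P' Q'))

/-! ### Negative correlation -/

/-- Two permutations with the same lower set that are both increasing on it and on its complement
agree. -/
theorem eq_of_lowerSet_eq {n j : ℕ} {τ τ' : Equiv.Perm (Fin n)}
    (hl : ∀ a, (τ a : ℕ) < j ↔ (τ' a : ℕ) < j)
    (h : ∀ a b, a < b → ((τ a : ℕ) < j ↔ (τ b : ℕ) < j) → τ a < τ b)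
    (h' : ∀ a b, a < b → ((τ' a : ℕ) < j ↔ (τ' b : ℕ) < j) → τ' a < τ' b) : τ = τ' := by
  have hiff : ∀ a b, τ a < τ b → τ' a < τ' b := by
    intro a b hab
    by_cases hs : (τ a : ℕ) < j ↔ (τ b : ℕ) < j
    · rcases lt_trichotomy a b with hlt | rfl | hlt
      · exact h' a b hlt (by rwa [← hl, ← hl])
      · exact absurd hab (lt_irrefl _)
      · exact absurd (h b a hlt hs.symm) (lt_asymm hab)
    -- In different blocks the order is forced: values below j precede the others.
    · have ha := hl a
      have hb := hl b
      rw [Fin.lt_def] at hab ⊢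
      omega
  -- τ' ∘ τ⁻¹ is an order automorphism of `Fin n`, hence the identity.
  have hmono : StrictMono (τ.symm.trans τ') := fun x y hxy =>
    hiff _ _ (by simpa using hxy)
  have hid : ∀ x, (τ.symm.trans τ') x = x := fun x => by
    have := Subsingleton.elim
      (hmono.orderIsoOfSurjective _ (τ.symm.trans τ').surjective) (OrderIso.refl (Fin n))
    exact DFunLike.congr_fun this x
  ext a
  simpa using (congrArg Fin.val (hid (τ a))).symm

/-- Any a < b is comparable in a permutation poset or in its reversal, so every τ in the
intersection is increasing on each block and is recovered from its lower set. -/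
theorem ncard_mixedEvent_inter_le {n j : ℕ} (hj : j ≤ n) (π σ : Equiv.Perm (Fin n)) :
    (mixedEvent (permPoset π) (permPoset σ) j ∩
      mixedEvent (permPoset (permBar π)) (permPoset (permBar σ)) j).ncard ≤ n.choose j := by
  have hincr : ∀ τ ∈ mixedEvent (permPoset π) (permPoset σ) j ∩
      mixedEvent (permPoset (permBar π)) (permPoset (permBar σ)) j,
      ∀ a b, a < b → ((τ a : ℕ) < j ↔ (τ b : ℕ) < j) → τ a < τ b := by
    rintro τ ⟨h₁, h₂⟩ a b hab hs
    rw [mem_mixedEvent_iff hj] at h₁ h₂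
    by_cases ha : (τ a : ℕ) < j
    · exact (permPoset_lt_or_permBar_lt π hab).elim (h₁.1 a b ha (hs.1 ha)) (h₂.1 a b ha (hs.1 ha))
    · have hb := mt hs.2 ha
      exact (permPoset_lt_or_permBar_lt σ hab).elim (h₁.2 a b ha hb) (h₂.2 a b ha hb)
  have hcard : (((Finset.univ : Finset (Fin n)).powersetCard j : Finset _) :
      Set (Finset (Fin n))).ncard = n.choose j := by
    rw [Set.ncard_coe_finset, Finset.card_powersetCard, Finset.card_univ, Fintype.card_fin]
  rw [← hcard]
  refine Set.ncard_le_ncard_of_injOn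
    (fun τ => Finset.univ.filter fun a : Fin n => (τ a : ℕ) < j) ?_ ?_ (Set.toFinite _)
  · intro τ _
    rw [Finset.mem_coe, Finset.mem_powersetCard]
    refine ⟨Finset.subset_univ _, ?_⟩
    have hmap : (Finset.univ.filter fun a : Fin n => (τ a : ℕ) < j).map τ.toEmbedding =
        Finset.univ.filter fun i : Fin n => (i : ℕ) < j := by
      ext i
      simp
    rw [← Finset.card_map τ.toEmbedding, hmap, Fin.card_filter_val_lt, min_eq_right hj]
  · intro τ hτ τ' hτ' heq
    refine eq_of_lowerSet_eq (fun a => ?_) (hincr τ hτ) (hincr τ' hτ')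
    simpa using Finset.ext_iff.1 heq a

theorem uniformPermMeasure_apply {n : ℕ} (A : Set (Equiv.Perm (Fin n))) :
    uniformPermMeasure n A = (A.ncard : ENNReal) / (n.factorial : ENNReal) := by
  classical
  let _ : MeasurableSpace (Equiv.Perm (Fin n)) := ⊤
  have h := PMF.toMeasure_uniformOfFintype_apply (α := Equiv.Perm (Fin n)) (s := A) trivial
  rw [Fintype.card_perm, Fintype.card_fin, ← Nat.card_eq_fintype_card] at h
  exact h

theorem negativelyCorrelated_of_ncard_le {n : ℕ} {A B : Set (Equiv.Perm (Fin n))}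
    (h : n.factorial * (A ∩ B).ncard ≤ A.ncard * B.ncard) : NegativelyCorrelated A B := by
  have h₀ : (n.factorial : ENNReal) ≠ 0 := by exact_mod_cast n.factorial_ne_zero
  have ht : (n.factorial : ENNReal) ≠ ⊤ := ENNReal.natCast_ne_top _
  unfold NegativelyCorrelated
  -- Expanding the left fraction by n! puts both sides over n!².
  rw [uniformPermMeasure_apply, uniformPermMeasure_apply, uniformPermMeasure_apply,
    ← ENNReal.mul_div_mul_left ((A ∩ B).ncard : ENNReal) _ h₀ ht, div_eq_mul_inv, div_eq_mul_inv,
    div_eq_mul_inv, mul_mul_mul_comm, ENNReal.mul_inv (Or.inl h₀) (Or.inl ht)]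
  refine mul_le_mul' ?_ le_rfl
  exact_mod_cast h

theorem mainTheorem5 (n : ℕ) (π σ : Equiv.Perm (Fin n)) (j : ℕ) (hj : j ≤ n) :
    mixedCount (permPoset π) (permPoset σ) j *
        mixedCount (permPoset (permBar π)) (permPoset (permBar σ)) j ≥
      n.factorial * n.choose j ∧
    NegativelyCorrelated (mixedEvent (permPoset π) (permPoset σ) j)
      (mixedEvent (permPoset (permBar π)) (permPoset (permBar σ)) j) := by
  have h := factorial_mul_choose_le_mixedCount_mul (P := permPoset π)
    (P' := permPoset (permBar π)) (Q := permPoset σ) (Q' := permPoset (permBar σ)) hj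
    (not_permPoset_permBar_lt π) (not_permPoset_permBar_lt σ)
  exact ⟨h, negativelyCorrelated_of_ncard_le
    ((Nat.mul_le_mul_left _ (ncard_mixedEvent_inter_le hj π σ)).trans h)⟩
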